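/- Let $K$ be an algebraically closed field of characteristic $0$ and $V$ a $K$-vector space of finite dimension $n$. All partitions below have length less than $n$. \emph{Schur modules.} For a straight or skew diagram $s$ let $E^{\otimes s}$ be the tensor power of a vector space $E$ with one factor for each cell of $s$, let $a_s$ be the sum of all permutations of the factors that preserve the rows of $s$, and let $b_s$ be the signed sum of all permutations that preserve the columns. Put $\mathbb S_\lambda E=b_\lambda a_\lambda(E^{\otimes\lambda})\subset b_\lambda(E^{\otimes\lambda})=\bigwedge^{\lambda_1'}E\otimes\bigwedge^{\lambda_2'}E\otimes\cdots$ (with $v_1\wedge\dots\wedge v_k=\sum_\tau \operatorname{sign}(\tau)\,v_{\tau(1)}\otimes\dots\otimes v_{\tau(k)}$) and $\mathbb S^\bullet V^*=\bigoplus_\lambda \mathbb S_\lambda V^*$. \emph{Multiplication.} Let $T$ be a Littlewood--Richardson tableau of shape $\nu/\lambda$ and content $\mu$. Let $\sigma_T:\nu/\lambda\to\mu$ be the bijection that sends a cell $c$ to the cell of $\mu$ in row $T(c)$ and column $j$, if $c$ contains the $j$-th letter $T(c)$ of $T$ when the rows are read from top to bottom and each row from right to left. Then $\mathcal M^{\lambda,\mu}_{\nu,T}:\mathbb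 S_\lambda V^*\otimes\mathbb S_\mu V^*\to\mathbb S_\nu V^*$ applies $a_\lambda\otimes a_\mu$, moves the factor in the cell $\sigma_T(c)$ of $\mu$ to the cell $c$ of $\nu/\lambda$ for each $c$, applies $a_{\nu/\lambda}$ to these factors, multiplies row by row in the symmetric powers, $\operatorname{Sym}^{\lambda_i}V^*\otimes\operatorname{Sym}^{\nu_i-\lambda_i}V^*\to\operatorname{Sym}^{\nu_i}V^*$, and finally applies $b_\nu$. An \emph{ideal} of $\mathbb S^\bullet V^*$ is a linear subspace $J$ such that for all $\lambda,\mu,\nu$, all such $T$, all $g\in J$ and all $h$, one has $\mathcal M^{\lambda,\mu}_{\nu,T}(g_\lambda\otimes h)\in J$ if $h\in\mathbb S_\mu V^*$, and $\mathcal M^{\lambda,\mu}_{\nu,T}(h\otimes g_\mu)\in J$ if $h\in\mathbb S_\lambda V^*$; here $g_\lambda$ is the component of $g$ in $\mathbb S_\lambda V^*$. \emph{Apolarity.} For $f\in\mathbb S_\eta V$ and $g\in\mathbb S_\mu V^*$ let $\varphi(f\otimes g)=0$ if $\mu\not\subset\eta$; otherwise let $\varphi(f\otimes g)\in\bigotimes_j\bigwedge^{\eta_j'-\mu_j'}V$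 be given by the tensor product over the columns $j$ of the maps $\bigwedge^{k}V\otimes\bigwedge^{h}V^*\to\bigwedge^{k-h}V$, $$(v_1\wedge\dots\wedge v_k)\otimes(\alpha_1\wedge\dots\wedge\alpha_h)\mapsto\sum_{R\subset\{1,\dots,k\},\ |R|=h}\operatorname{sign}(R)\,\det(\alpha_i(v_j))_{1\le i\le h,\ j\in R}\;v_{\overline R},$$ where $\operatorname{sign}(R)$ is the sign of the permutation that lists $R$ first and then its complement $\overline R$, both in increasing order. Extend $\varphi(f\otimes -)$ to $\mathbb S^\bullet V^*$ as the direct sum of these maps over $\mu$, and let $f^\perp=\bigoplus_\mu\ker\big(\varphi(f\otimes -)|_{\mathbb S_\mu V^*}\big)$. \emph{Rank one and the ideal of a point.} Let $\eta$ be a partition with $k$ distinct positive parts, let $h_1<\dots<h_k$ be the distinct heights of the columns of its diagram, and let $d_i\ge1$ be the number of columns of height $h_i$. The flag variety $X\subset\mathbb P(\mathbb S_\eta V)$ consists of the classes of the tensors $$(v_1\wedge\dots\wedge v_{h_k})^{\otimes d_k}\otimes\dots\otimes(v_1\wedge\dots\wedge v_{h_1})^{\otimes d_1},\qquad v_1,\dots,v_{h_k}\in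 V\text{ linearly independent},$$ and the $\eta$-rank of $p\in\mathbb S_\eta V$ is the least $r$ such that $p$ lies in the span of $r$ points of $X$. If $p$ has $\eta$-rank $1$, so that $p$ is a nonzero multiple of a tensor as above, put $W_i=\langle v_1,\dots,v_{h_i}\rangle$ and let $W_i^\perp\subset V^*$ be the annihilator of $W_i$. Let $I(p)$ be the ideal of $\mathbb S^\bullet V^*$ generated by the subspaces $\operatorname{Sym}^{d_k+\dots+d_{i+1}+1}W_i^\perp$ of $\mathbb S_{(d_k+\dots+d_{i+1}+1)}V^*$, for $i=1,\dots,k$. \textbf{Proposition.} Let $\eta$ be a partition of length less than $n$. (1) If $p\in\mathbb S_\eta V$ has $\eta$-rank $1$, then $\varphi(p\otimes g)=0$ for every $g\in I(p)$. (2) For every $f\in\mathbb S_\eta V$, the apolar set $f^\perp$ is an ideal of $\mathbb S^\bullet V^*$. -/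

import Mathlib

open scoped TensorProduct DirectSum

noncomputable section

namespace SchurApolarity

instance : DecidableEq YoungDiagram := fun a b =>
  decidable_of_iff (a.cells = b.cells) YoungDiagram.ext_iff.symm

/-! ## Tensors indexed by the cells of a diagram

Cells are pairs `(i, j)` (row `i`, column `j`, counted from `0`).  A straight or skew diagram is a
finite set of cells, and `TPow K E s` is the tensor power `E^{⊗ s}` with one factor per cell. -/

/-- The tensor power `E^{⊗ s}` with one factor for each cell in `s`. -/
abbrev TPow (K E : Type*) [Field K] [AddCommGroup E] [Module K E] (s : Finset (ℕ × ℕ)) : Type _ :=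
  ⨂[K] _ : s, E

/-- The permutations of the cells of `s` which preserve every row. -/
def rowPerms (s : Finset (ℕ × ℕ)) : Finset (Equiv.Perm s) :=
  Finset.univ.filter fun σ => ∀ c, (σ c).1.1 = c.1.1

/-- The permutations of the cells of `s` which preserve every column. -/
def colPerms (s : Finset (ℕ × ℕ)) : Finset (Equiv.Perm s) :=
  Finset.univ.filter fun σ => ∀ c, (σ c).1.2 = c.1.2

section Symmetrizers

variable (K E : Type*) [Field K] [AddCommGroup E] [Module K E]

/-- The operator permuting the factors of `E^{⊗ s}`. -/
def permute {s : Finset (ℕ × ℕ)} (σ : Equiv.Perm s) : TPow K E s →ₗ[K] TPow K E s :=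
  (PiTensorProduct.reindex K (fun _ : s => E) σ).toLinearMap

/-- The row symmetrizer `a_s = ∑_{σ ∈ R_s} σ`.  Its image is `Sym_s E`, the tensor product over the
rows of the symmetric powers, realised as symmetric tensors. -/
def rowSym (s : Finset (ℕ × ℕ)) : TPow K E s →ₗ[K] TPow K E s :=
  ∑ σ ∈ rowPerms s, permute K E σ

/-- The column antisymmetrizer `b_s = ∑_{τ ∈ C_s} sign(τ) τ`.  Its image is the tensor product over
the columns of the exterior powers, where `v₁ ∧ ⋯ ∧ v_k` is the antisymmetric tensor
`∑_τ sign(τ) v_{τ(1)} ⊗ ⋯ ⊗ v_{τ(k)}`. -/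
def colAlt (s : Finset (ℕ × ℕ)) : TPow K E s →ₗ[K] TPow K E s :=
  ∑ τ ∈ colPerms s, ((Equiv.Perm.sign τ : ℤ) : K) • permute K E τ

/-- The Young symmetrizer `c_s = b_s ∘ a_s`. -/
def youngSym (s : Finset (ℕ × ℕ)) : TPow K E s →ₗ[K] TPow K E s :=
  colAlt K E s ∘ₗ rowSym K E s

/-- The Schur module `S_l E`: the image of the Young symmetrizer. -/
def schurModule (l : YoungDiagram) : Submodule K (TPow K E l.cells) :=
  LinearMap.range (youngSym K E l.cells)

end Symmetrizers

/-- If `s ⊆ t`, the cells of `t` are those of `s` together with those of `t \ s`. -/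
def splitCells {s t : Finset (ℕ × ℕ)} (h : s ⊆ t) : s ⊕ (t \ s : Finset (ℕ × ℕ)) ≃ t where
  toFun := Sum.elim (fun c => ⟨c.1, h c.2⟩) (fun c => ⟨c.1, (Finset.mem_sdiff.1 c.2).1⟩)
  invFun c := if hc : c.1 ∈ s then Sum.inl ⟨c.1, hc⟩
    else Sum.inr ⟨c.1, Finset.mem_sdiff.2 ⟨c.2, hc⟩⟩
  left_inv := by
    rintro (c | c)
    · simp
    · simp [(Finset.mem_sdiff.1 c.2).2]
  right_inv c := by
    by_cases hc : c.1 ∈ s <;> simp [hc]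

/-- The identification `E^{⊗ s} ⊗ E^{⊗ (t \ s)} ≃ E^{⊗ t}` for `s ⊆ t`. -/
def joinTensor (K E : Type*) [Field K] [AddCommGroup E] [Module K E] {s t : Finset (ℕ × ℕ)}
    (h : s ⊆ t) : TPow K E s ⊗[K] TPow K E (t \ s) ≃ₗ[K] TPow K E t :=
  (PiTensorProduct.tmulEquiv K E).trans (PiTensorProduct.reindex K (fun _ => E) (splitCells h))

/-! ## Littlewood-Richardson tableaux and the multiplication maps -/

/-- `c` is read no later than `d` when the rows are read from top to bottom, each one from right
to left, i.e. in the reverse of the order in which the word of a skew tableau is formed. -/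
def ReadBefore (c d : ℕ × ℕ) : Prop :=
  c.1 < d.1 ∨ (c.1 = d.1 ∧ d.2 ≤ c.2)

instance (c d : ℕ × ℕ) : Decidable (ReadBefore c d) := by
  unfold ReadBefore; infer_instance

/-- A Littlewood-Richardson skew tableau of shape `nu / lam` and content `mu`: a semistandard
filling whose word is a Yamanouchi word (reverse lattice word).  The letters are counted from `0`,
so the letter `i` stands for `i + 1` and occurs `mu.rowLen i` times. -/
structure LRTableau (lam mu nu : YoungDiagram) where
  le : lam ≤ nu
  entry : (nu.cells \ lam.cells : Finset (ℕ × ℕ)) → ℕ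
  row_weak : ∀ c d : (nu.cells \ lam.cells : Finset (ℕ × ℕ)),
    c.1.1 = d.1.1 → c.1.2 < d.1.2 → entry c ≤ entry d
  col_strict : ∀ c d : (nu.cells \ lam.cells : Finset (ℕ × ℕ)),
    c.1.2 = d.1.2 → c.1.1 < d.1.1 → entry c < entry d
  content : ∀ i, (Finset.univ.filter fun c => entry c = i).card = mu.rowLen i
  yamanouchi : ∀ (c : (nu.cells \ lam.cells : Finset (ℕ × ℕ))) (i : ℕ),
    (Finset.univ.filter fun d => ReadBefore d.1 c.1 ∧ entry d = i + 1).card ≤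
      (Finset.univ.filter fun d => ReadBefore d.1 c.1 ∧ entry d = i).card

namespace LRTableau

variable {lam mu nu : YoungDiagram} (T : LRTableau lam mu nu)

/-- The conjugate filling `T'` (counted from `0`): if `T` has the letter `i` in the cell `c`, then
`T'(c)` is the number of letters `i` read strictly before the one in `c`.  Indeed, the `j`-th letter
`i` in the reversed word of `T` records the entry of the cell `(i, j)` of the standard tableau
attached to that word, which lies in the row `j` of the conjugate standard tableau. -/
def conjEntry (c : (nu.cells \ lam.cells : Finset (ℕ × ℕ))) : ℕ :=
  (Finset.univ.filter fun d => (ReadBefore d.1 c.1 ∧ d ≠ c) ∧ T.entry d = T.entry c).card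

theorem conjEntry_lt (c : (nu.cells \ lam.cells : Finset (ℕ × ℕ))) :
    T.conjEntry c < mu.rowLen (T.entry c) := by
  rw [← T.content]
  apply Finset.card_lt_card
  rw [Finset.ssubset_iff_of_subset]
  · exact ⟨c, by simp, by simp⟩
  · intro d
    simp only [Finset.mem_filter]
    exact fun h => ⟨h.1, h.2.2⟩

theorem conjEntry_lt_conjEntry {c d : (nu.cells \ lam.cells : Finset (ℕ × ℕ))}
    (h : ReadBefore c.1 d.1) (hne : c ≠ d) (he : T.entry c = T.entry d) :
    T.conjEntry c < T.conjEntry d := by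
  apply Finset.card_lt_card
  rw [Finset.ssubset_iff_of_subset]
  · exact ⟨c, by simp [h, hne, he], by simp⟩
  · intro e
    simp only [Finset.mem_filter, Finset.mem_univ, true_and]
    rintro ⟨⟨h1, h2⟩, h3⟩
    refine ⟨⟨?_, ?_⟩, h3.trans he⟩
    · unfold ReadBefore at *; omega
    · rintro rfl
      apply h2
      apply Subtype.ext
      apply Prod.ext <;> (unfold ReadBefore at *; omega)

/-- The map `σ_T : nu / lam → mu`, `c ↦ (T(c), T'(c))`. -/
def cellMap (c : (nu.cells \ lam.cells : Finset (ℕ × ℕ))) : mu.cells :=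
  ⟨(T.entry c, T.conjEntry c), by
    rw [YoungDiagram.mem_cells]
    exact YoungDiagram.mem_iff_lt_rowLen.2 (T.conjEntry_lt c)⟩

theorem cellMap_injective : Function.Injective T.cellMap := by
  intro c d h
  have h1 : T.entry c = T.entry d := congrArg (fun x => x.1.1) h
  have h2 : T.conjEntry c = T.conjEntry d := congrArg (fun x => x.1.2) h
  by_contra hne
  have : ReadBefore c.1 d.1 ∨ ReadBefore d.1 c.1 := by unfold ReadBefore; omega
  rcases this with h | h
  · have := T.conjEntry_lt_conjEntry h hne h1
    omega
  · have := T.conjEntry_lt_conjEntry h (Ne.symm hne) h1.symm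
    omega

theorem cellMap_bijective : Function.Bijective T.cellMap := by
  refine ⟨T.cellMap_injective, ?_⟩
  intro x
  have hmaps : ∀ c ∈ (Finset.univ.filter fun c => T.entry c = x.1.1),
      T.conjEntry c ∈ Finset.range (mu.rowLen x.1.1) := by
    intro c hc
    have hc' := (Finset.mem_filter.1 hc).2
    rw [Finset.mem_range, ← hc']
    exact T.conjEntry_lt c
  have hinj : Set.InjOn T.conjEntry (Finset.univ.filter fun c => T.entry c = x.1.1) := by
    intro c hc d hd h
    apply T.cellMap_injective
    apply Subtype.ext
    have hc' := (Finset.mem_filter.1 hc).2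
    have hd' := (Finset.mem_filter.1 hd).2
    exact Prod.ext (hc'.trans hd'.symm) h
  have hsurj := Finset.surjOn_of_injOn_of_card_le T.conjEntry hmaps hinj
    (by rw [T.content, Finset.card_range])
  have hx : x.1.2 ∈ (Finset.range (mu.rowLen x.1.1) : Set ℕ) := by
    have := x.2
    rw [YoungDiagram.mem_cells] at this
    simpa using YoungDiagram.mem_iff_lt_rowLen.1 this
  obtain ⟨c, hc, hcx⟩ := hsurj hx
  exact ⟨c, Subtype.ext (Prod.ext (Finset.mem_filter.1 hc).2 hcx)⟩

/-- The bijection `σ_T : nu / lam ≃ mu`. -/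
def cellEquiv : (nu.cells \ lam.cells : Finset (ℕ × ℕ)) ≃ mu.cells :=
  Equiv.ofBijective T.cellMap T.cellMap_bijective

variable (K E : Type*) [Field K] [AddCommGroup E] [Module K E]

/-- The map `Sym_mu E → E^{⊗ mu} → E^{⊗ nu/lam} → Sym_{nu/lam} E` which moves the factor in the cell
`σ_T(c)` of `mu` to the cell `c` of `nu / lam` and then applies the row symmetrizer. -/
def transport : TPow K E mu.cells →ₗ[K] TPow K E (nu.cells \ lam.cells) :=
  rowSym K E (nu.cells \ lam.cells) ∘ₗ
    (PiTensorProduct.reindex K (fun _ : mu.cells => E) T.cellEquiv.symm).toLinearMap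

/-- The product `Sym_lam E ⊗ Sym_{nu/lam} E → Sym_nu E`, i.e. row by row the product of symmetric
powers `Sym^p ⊗ Sym^q → Sym^{p+q}`.  As the product `x₁ ⋯ x_m` is the symmetric tensor
`∑_σ x_{σ(1)} ⊗ ⋯ ⊗ x_{σ(m)}`, this is the row symmetrization of the tensor product, divided by
the orders of the two smaller row groups. -/
def rowMul {lam nu : YoungDiagram} (h : lam ≤ nu) :
    TPow K E lam.cells →ₗ[K] TPow K E (nu.cells \ lam.cells) →ₗ[K] TPow K E nu.cells :=
  (((rowPerms lam.cells).card * (rowPerms (nu.cells \ lam.cells)).card : K)⁻¹) •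
    (TensorProduct.mk K (TPow K E lam.cells) (TPow K E (nu.cells \ lam.cells))).compr₂
      (rowSym K E nu.cells ∘ₗ
        (joinTensor K E (YoungDiagram.cells_subset_iff.2 h)).toLinearMap)

/-- The multiplication map on tensors: `(x, y) ↦ b_nu (a_lam x · transport (a_mu y))`. -/
def mulTensor : TPow K E lam.cells →ₗ[K] TPow K E mu.cells →ₗ[K] TPow K E nu.cells :=
  ((rowMul K E T.le).compl₁₂ (rowSym K E lam.cells)
    (T.transport K E ∘ₗ rowSym K E mu.cells)).compr₂ (colAlt K E nu.cells)

theorem mulTensor_mem (x : TPow K E lam.cells) (y : TPow K E mu.cells) :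
    T.mulTensor K E x y ∈ schurModule K E nu := by
  refine ⟨((rowPerms lam.cells).card * (rowPerms (nu.cells \ lam.cells)).card : K)⁻¹ •
    joinTensor K E (YoungDiagram.cells_subset_iff.2 T.le)
      (rowSym K E lam.cells x ⊗ₜ T.transport K E (rowSym K E mu.cells y)), ?_⟩
  simp [mulTensor, rowMul, youngSym]

/-- The multiplication map `M^{lam,mu}_{nu,T} : S_lam E ⊗ S_mu E → S_nu E`. -/
def mul (x : schurModule K E lam) (y : schurModule K E mu) : schurModule K E nu :=
  ⟨T.mulTensor K E x.1 y.1, T.mulTensor_mem K E x.1 y.1⟩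

end LRTableau

/-! ## The graded space of Schur modules and its ideals -/

/-- The partitions of length less than `n`. -/
abbrev ShortPartition (n : ℕ) : Type := {l : YoungDiagram // l.colLen 0 < n}

/-- The direct sum `S^• E` of the Schur modules `S_l E`, over all partitions `l` of length less
than `n` (to be used with `n = dim E`). -/
abbrev SchurSum (K E : Type*) [Field K] [AddCommGroup E] [Module K E] (n : ℕ) : Type _ :=
  ⨁ l : ShortPartition n, schurModule K E l.1

section Ideals

variable {K E : Type*} [Field K] [AddCommGroup E] [Module K E] {n : ℕ}

/-- A (two-sided) ideal of `S^• E` with respect to the multiplication maps `M^{lam,mu}_{nu,T}`: a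
linear subspace closed under multiplication, on either side and by means of any of these maps,
of (the homogeneous components of) its elements by arbitrary homogeneous elements. -/
def IsSchurIdeal (J : Submodule K (SchurSum K E n)) : Prop :=
  ∀ (lam mu nu : ShortPartition n) (T : LRTableau lam.1 mu.1 nu.1),
    (∀ g ∈ J, ∀ h : schurModule K E mu.1,
      DirectSum.lof K (ShortPartition n) (fun l => schurModule K E l.1) nu
        (T.mul K E (DirectSum.component K _ _ lam g) h) ∈ J) ∧
    (∀ g ∈ J, ∀ h : schurModule K E lam.1,
      DirectSum.lof K (ShortPartition n) (fun l => schurModule K E l.1) nu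
        (T.mul K E h (DirectSum.component K _ _ mu g)) ∈ J)

/-- The ideal generated by a set: the smallest ideal containing it. -/
def idealGenerated (S : Set (SchurSum K E n)) : Submodule K (SchurSum K E n) :=
  sInf {J | IsSchurIdeal J ∧ S ⊆ J}

end Ideals

/-! ## The Schur apolarity action -/

section Apolarity

variable {K V : Type*} [Field K] [AddCommGroup V] [Module K V]

/-- The contraction `V^{⊗ t} ⊗ (V^*)^{⊗ s} → V^{⊗ (t \ s)}` for `s ⊆ t`, which pairs the factors
in each cell of `s`. -/
def contract {s t : Finset (ℕ × ℕ)} (h : s ⊆ t) (f : TPow K V t) :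
    TPow K (Module.Dual K V) s →ₗ[K] TPow K V (t \ s) :=
  LinearMap.applyₗ ((joinTensor K V h).symm f) ∘ₗ
    LinearMap.llcomp K _ _ _ (TensorProduct.lid K (TPow K V (t \ s))).toLinearMap ∘ₗ
      LinearMap.rTensorHom (TPow K V (t \ s)) ∘ₗ PiTensorProduct.dualDistrib

open Classical in
/-- The catalecticant map `g ↦ φ(f ⊗ g)` on `S_mu V^*`, with values in the tensor power of shape
`eta / mu`, for `f ∈ S_eta V`; it is zero if `mu ⊄ eta`.  Otherwise `φ` is the tensor product over
the columns of the skew-symmetric apolarity actions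
`(v₁ ∧ ⋯ ∧ v_k) ⊗ (α₁ ∧ ⋯ ∧ α_h) ↦ ∑_R sign(R) det(α_i(v_j))_{j ∈ R} v_{R^c}`.
On antisymmetric tensors each of them is `1 / h!` times the contraction of the first `h` factors,
and the product of the numbers `h!` is the order of the column group of `mu`. -/
def catalecticant {eta : YoungDiagram} (f : schurModule K V eta) (mu : YoungDiagram) :
    schurModule K (Module.Dual K V) mu →ₗ[K] TPow K V (eta.cells \ mu.cells) :=
  if h : mu ≤ eta then
    ((colPerms mu.cells).card : K)⁻¹ •
      (contract (YoungDiagram.cells_subset_iff.2 h) f.1 ∘ₗ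
        (schurModule K (Module.Dual K V) mu).subtype)
  else 0

/-- The Schur apolarity action `g ↦ φ(f ⊗ g)` on `S^• V^*`, for `f ∈ S_eta V`. -/
def apolarity {eta : YoungDiagram} (f : schurModule K V eta) :
    SchurSum K (Module.Dual K V) (Module.finrank K V) →ₗ[K]
      ⨁ mu : ShortPartition (Module.finrank K V), TPow K V (eta.cells \ mu.1.cells) :=
  DirectSum.lmap fun mu => catalecticant f mu.1

/-- The apolar set `f^⊥`: the direct sum of the kernels of the catalecticant maps of `f`. -/
def apolarSet {eta : YoungDiagram} (f : schurModule K V eta) :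
    Submodule K (SchurSum K (Module.Dual K V) (Module.finrank K V)) :=
  ⨅ mu : ShortPartition (Module.finrank K V),
    (LinearMap.ker (catalecticant f mu.1)).comap (DirectSum.component K _ _ mu)

end Apolarity

/-! ## Points of rank one and their ideals -/

section RankOne

variable {K V : Type*} [Field K] [AddCommGroup V] [Module K V]

/-- The tensor whose `j`-th column is `v₁ ∧ ⋯ ∧ v_h` where `h` is the height of that column, i.e.
`(v₁ ∧ ⋯ ∧ v_{h_k})^{⊗ d_k} ⊗ ⋯ ⊗ (v₁ ∧ ⋯ ∧ v_{h_1})^{⊗ d_1}` (with `v 0 = v₁` and so on). -/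
def flagTensor (eta : YoungDiagram) (v : ℕ → V) : TPow K V eta.cells :=
  colAlt K V eta.cells (PiTensorProduct.tprod K fun c : eta.cells => v c.1.1)

/-- `p` is a nonzero multiple of the tensor attached to `v₁, v₂, …`, whose first `ℓ(eta)` members
are linearly independent.  (The further members play no role.) -/
def Represents {eta : YoungDiagram} (p : schurModule K V eta) (v : ℕ → V) : Prop :=
  LinearIndependent K (fun i : Fin (eta.colLen 0) => v i) ∧
    ∃ a : K, a ≠ 0 ∧ (p : TPow K V eta.cells) = a • flagTensor eta v

/-- The (punctured) affine cone over the flag variety `X ⊂ ℙ(S_eta V)`. -/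
def flagCone (K V : Type*) [Field K] [AddCommGroup V] [Module K V] (eta : YoungDiagram) :
    Set (schurModule K V eta) :=
  {p | ∃ v : ℕ → V, Represents p v}

/-- The `eta`-rank of `p`: the least number of points of the flag variety whose span contains
`p`. -/
def etaRank {eta : YoungDiagram} (p : schurModule K V eta) : ℕ :=
  sInf {r | ∃ q : Fin r → schurModule K V eta,
    (∀ i, q i ∈ flagCone K V eta) ∧ p ∈ Submodule.span K (Set.range q)}

/-- The diagram of the partition `(m)`: one row with `m` cells. -/
def oneRow (m : ℕ) : YoungDiagram where
  cells := {0} ×ˢ Finset.range m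
  isLowerSet := by
    rintro ⟨a, b⟩ ⟨c, d⟩ h hab
    simp only [Prod.mk_le_mk, Finset.coe_product, Finset.coe_singleton, Finset.coe_range,
      Set.mem_prod, Set.mem_singleton_iff, Set.mem_Iio] at *
    omega

/-- The subspace `Sym^m U` of `Sym^m E = S_(m) E`, for a subspace `U` of `E`: it is spanned by the
products of `m` elements of `U`. -/
def symPower {E : Type*} [AddCommGroup E] [Module K E] (U : Submodule K E) (m : ℕ) :
    Submodule K (schurModule K E (oneRow m)) :=
  Submodule.span K {x | ∃ u : (oneRow m).cells → E, (∀ c, u c ∈ U) ∧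
    (x : TPow K E (oneRow m).cells) = youngSym K E (oneRow m).cells (PiTensorProduct.tprod K u)}

/-- The numbers `h_1 < ⋯ < h_k`, i.e. the dimensions of the spaces of the flag: those `h ≥ 1` for
which the rows number `h` and `h + 1` (counted from `1`) of the diagram have different lengths. -/
def flagDims (eta : YoungDiagram) : Set ℕ :=
  {h | 0 < h ∧ eta.rowLen h < eta.rowLen (h - 1)}

/-- The generators of the ideal `I(p)`: the elements of `Sym^{d_k + ⋯ + d_{i+1} + 1} W_i^⊥`, where
`W_1 ⊂ ⋯ ⊂ W_k` is the flag represented by `p`, so that `W_i` is spanned by `v₁, …, v_{h_i}`.  The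
number `d_k + ⋯ + d_{i+1}`, where `d_j` is the number of columns of height `h_j`, is the length of
the row that follows the `h_i`-th one. -/
def idealGenerators {eta : YoungDiagram} (p : schurModule K V eta) :
    Set (SchurSum K (Module.Dual K V) (Module.finrank K V)) :=
  {g | ∃ v : ℕ → V, Represents p v ∧ ∃ h ∈ flagDims eta,
    ∃ hm : (oneRow (eta.rowLen h + 1)).colLen 0 < Module.finrank K V,
    ∃ x ∈ symPower (Submodule.span K (v '' Set.Iio h)).dualAnnihilator (eta.rowLen h + 1),
      g = DirectSum.lof K (ShortPartition (Module.finrank K V))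
        (fun l => schurModule K (Module.Dual K V) l.1) ⟨oneRow (eta.rowLen h + 1), hm⟩ x}

/-- The ideal `I(p)` associated to a point `p` of rank one. -/
def pointIdeal {eta : YoungDiagram} (p : schurModule K V eta) :
    Submodule K (SchurSum K (Module.Dual K V) (Module.finrank K V)) :=
  idealGenerated (idealGenerators p)

end RankOne

end SchurApolarity

end

open scoped TensorProduct DirectSum

noncomputable section

namespace SchurApolarity

/-! ### Straightening placements by exchange relations -/

section Straightening

variable {K A R I : Type*} [Field K] [CharZero K] [Fintype A] [Fintype I]
  [DecidableEq A] [DecidableEq R] [DecidableEq I] {cA : A → ℕ} {cI : I → ℕ}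

/-! In finite dimension, contracting `f ∈ S_eta V` with `g ∈ S_lam V^*` gives zero exactly when `f`
pairs to zero with every tensor `g ⊗ ξ` whose `g`-factors occupy their own cells of `eta`. The key
claim is that `f` then pairs to zero with `g ⊗ ξ` for every placement of the factors in the cells of
`eta`.

Fix `ξ` and regard the pairing as a function `F` of the placement `w`. Both Schur modules satisfy
column antisymmetry and the one-cell exchange relations (`schurModule_exchange`), so `F` satisfies
them in the cells of `eta` and in the letters of `lam` (`isExchange_dualDistrib`). If `F` is nonzero
somewhere, straightening yields a placement with `F ≠ 0` and every letter in its own column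
(`IsExchange.exists_col`). Comparing column heights gives `lam ⊆ eta`, and antisymmetry then moves
each letter to its own cell (`IsExchange.exists_eq`), contradicting apolarity.

A product of `g` with `h`, on either side, is a linear combination of permutations of tensors `g ⊗
ξ`, and tensoring it further keeps that form. The claim therefore makes the product apolar to `f`,
which proves (2). By (2) and the minimality of `I(p)`, part (1) need only be checked on generators:
in a suitable column of the flag tensor, a functional in `W_i^⊥` always meets a vector of `W_i`. -/

theorem trans_swap_apply {α β : Type*} [DecidableEq α] [DecidableEq β] (w : α ≃ β) (a b : α) :
    w.trans (Equiv.swap (w a) (w b)) = (Equiv.swap a b).trans w := by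
  ext c
  simp [Equiv.swap_apply_def, apply_ite w]

/-- A function of the placements `w` of letters in cells which satisfies, on both sides, the
antisymmetry in the columns and the exchange relations between a cell and a column to its left. -/
structure IsExchange (cA : A → ℕ) (cI : I → ℕ) (F : A ⊕ R ≃ I → K) : Prop where
  cell_swap : ∀ w a b, a ≠ b → cI a = cI b → F (w.trans (Equiv.swap a b)) = -F w
  cell_exchange : ∀ w x k, k < cI x →
    F w = ∑ i with cI i = k, F (w.trans (Equiv.swap x i))
  letter_swap : ∀ w a b, a ≠ b → cA a = cA b →
    F ((Equiv.swap (.inl a) (.inl b)).trans w) = -F w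
  letter_exchange : ∀ w x k, k < cA x →
    F w = ∑ i with cA i = k, F ((Equiv.swap (.inl x) (.inl i)).trans w)

theorem eq_zero_of_eq_neg_mul {a : K} (n : ℕ) (h : a = n * -a) : a = 0 := by
  have h1 : ((n + 1 : ℕ) : K) * a = 0 := by push_cast; linear_combination h
  exact (mul_eq_zero.1 h1).resolve_left (Nat.cast_ne_zero.2 n.succ_ne_zero)

variable {F : A ⊕ R ≃ I → K}

/-- If the letters of a column `k` fill cells of the column `k`, no letter of a later column may be
placed there. -/
theorem IsExchange.col_ne (hF : IsExchange cA cI F) {w : A ⊕ R ≃ I} (hw : F w ≠ 0) {k : ℕ}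
    (hk : ∀ c, cA c = k → cI (w (.inl c)) = k) {x : A} (hx : k < cA x) :
    cI (w (.inl x)) ≠ k := by
  intro hxk
  -- The letter `x` and all letters of column `k` lie in cell column `k`, so exchanging two of them
  -- is a swap inside one column of cells. Every term of the letter exchange is thus `-F w`, and `F
  -- w = -n * F w` forces zero in characteristic `0`.
  refine hw (eq_zero_of_eq_neg_mul (Finset.univ.filter fun i => cA i = k).card ?_)
  conv_lhs => rw [hF.letter_exchange w x k hx]
  rw [← nsmul_eq_mul]
  refine Finset.sum_eq_card_nsmul fun i hi => ?_
  have hi : cA i = k := by simpa using hi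
  rw [← trans_swap_apply, hF.cell_swap]
  · intro h
    have := congrArg cA (Sum.inl_injective (w.injective h))
    omega
  · rw [hxk, hk i hi]

variable [Fintype R]

/-- Take a placement with the most letters of column `j` in cell column `j`. A misplaced letter of
column `j` cannot lie further left, by `IsExchange.col_ne`. If it lies further right, exchange its
cell with those of column `j`: a cell holding a letter of column `j` contributes `-F w`, any other
contributes `0` by maximality. -/
theorem IsExchange.exists_succ (hF : IsExchange cA cI F) {w₀ : A ⊕ R ≃ I} (h₀ : F w₀ ≠ 0) (j : ℕ)
    (hw₀ : ∀ c, cA c < j → cI (w₀ (.inl c)) = cA c) :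
    ∃ w, F w ≠ 0 ∧ ∀ c, cA c < j + 1 → cI (w (.inl c)) = cA c := by
  classical
  let N : (A ⊕ R ≃ I) → Finset A := fun w => {c | cA c = j ∧ cI (w (.inl c)) = j}
  have hN : ∀ w c, c ∈ N w ↔ cA c = j ∧ cI (w (.inl c)) = j := fun w c => by simp [N]
  obtain ⟨w, hw, hmax⟩ := Finset.exists_max_image
    (Finset.univ.filter fun w : A ⊕ R ≃ I => F w ≠ 0 ∧ ∀ c, cA c < j → cI (w (.inl c)) = cA c)
    (fun w => (N w).card) ⟨w₀, by simpa using ⟨h₀, hw₀⟩⟩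
  simp only [Finset.mem_filter, Finset.mem_univ, true_and] at hw hmax
  obtain ⟨hw, hgood⟩ := hw
  refine ⟨w, hw, fun c hc => ?_⟩
  rcases Nat.lt_succ_iff_lt_or_eq.1 hc with hc | hc
  · exact hgood c hc
  by_contra hne
  rw [hc] at hne
  have hlt : j < cI (w (.inl c)) := by
    rcases lt_trichotomy (cI (w (.inl c))) j with h | h | h
    · exact absurd rfl (hF.col_ne hw (fun d hd => by rw [hgood d (hd ▸ h), hd]) (hc ▸ h))
    · exact absurd h hne
    · exact h
  refine hw (eq_zero_of_eq_neg_mul (N w).card ?_)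
  conv_lhs => rw [hF.cell_exchange w _ j hlt]
  have hcN : c ∉ N w := by simp [hN, hne]
  have hsub : (N w).map ⟨fun d => w (.inl d), fun a b h => Sum.inl_injective (w.injective h)⟩ ⊆
      Finset.univ.filter fun i => cI i = j := by
    intro i
    simp only [Finset.mem_map, Finset.mem_filter, Finset.mem_univ, true_and]
    rintro ⟨d, hd, rfl⟩
    exact ((hN w d).1 hd).2
  rw [← Finset.sum_subset hsub, Finset.sum_map, ← nsmul_eq_mul]
  · refine Finset.sum_eq_card_nsmul fun d hd => ?_
    have hd' := (hN w d).1 hd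
    change F (w.trans (Equiv.swap (w (.inl c)) (w (.inl d)))) = -F w
    rw [trans_swap_apply, hF.letter_swap]
    · rintro rfl; exact hcN hd
    · rw [hc, hd'.1]
  · intro i hi hiN
    have hi : cI i = j := by simpa using hi
    by_contra h
    -- The swap brings `c` into column `j` and displaces no letter of column `j` from it. Letters of
    -- earlier columns sit in cells left of column `j`, so they stay put.
    have hle := hmax _ ⟨h, fun d hd => ?_⟩
    · refine absurd hle (not_le.2 (Finset.card_lt_card ?_))
      rw [Finset.ssubset_iff_of_subset]
      · exact ⟨c, (hN _ _).2 (by simp [hc, hi]), hcN⟩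
      · intro d hd
        have hd' := (hN w d).1 hd
        have h1 : w (.inl d) ≠ w (.inl c) := by
          intro h; rw [h] at hd'; omega
        have h2 : w (.inl d) ≠ i := by
          rintro rfl
          exact hiN (Finset.mem_map.2 ⟨d, hd, rfl⟩)
        exact (hN _ _).2 (by simp [hd'.1, Equiv.swap_apply_of_ne_of_ne h1 h2, hd'.2])
    · have := hgood d hd
      rw [Equiv.trans_apply, Equiv.swap_apply_of_ne_of_ne, this]
      · intro h; rw [h] at this; omega
      · intro h; rw [h] at this; omega

theorem IsExchange.exists_col (hF : IsExchange cA cI F) {w₀ : A ⊕ R ≃ I} (h₀ : F w₀ ≠ 0) :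
    ∃ w, F w ≠ 0 ∧ ∀ c, cI (w (.inl c)) = cA c := by
  have key : ∀ j, ∃ w, F w ≠ 0 ∧ ∀ c, cA c < j → cI (w (.inl c)) = cA c := by
    intro j
    induction j with
    | zero => exact ⟨w₀, h₀, by simp⟩
    | succ j ih =>
      obtain ⟨w, hw, hj⟩ := ih
      exact hF.exists_succ hw j hj
  obtain ⟨w, hw, h⟩ := key (Finset.univ.sup cA + 1)
  exact ⟨w, hw, fun c => h c (Nat.lt_succ_of_le (Finset.le_sup (Finset.mem_univ c)))⟩

/-- Inside the columns, the letters may be moved to prescribed cells. -/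
theorem IsExchange.exists_eq (hF : IsExchange cA cI F) {w₀ : A ⊕ R ≃ I} (h₀ : F w₀ ≠ 0)
    (e : A → I) (he : Function.Injective e) (hcol : ∀ c, cI (e c) = cA c) :
    ∃ w, F w ≠ 0 ∧ ∀ c, w (.inl c) = e c := by
  classical
  let N : (A ⊕ R ≃ I) → Finset A := fun w => {c | w (.inl c) = e c}
  have hN : ∀ w c, c ∈ N w ↔ w (.inl c) = e c := fun w c => by simp [N]
  obtain ⟨w₁, h₁⟩ := hF.exists_col h₀
  obtain ⟨w, hw, hmax⟩ := Finset.exists_max_image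
    (Finset.univ.filter fun w : A ⊕ R ≃ I => F w ≠ 0 ∧ ∀ c, cI (w (.inl c)) = cA c)
    (fun w => (N w).card) ⟨w₁, by simpa using h₁⟩
  simp only [Finset.mem_filter, Finset.mem_univ, true_and] at hw hmax
  obtain ⟨hw, hgood⟩ := hw
  refine ⟨w, hw, fun c => ?_⟩
  by_contra hne
  -- The letter `c` and its target lie in one column, so swapping these cells only changes the sign
  -- of `F`, while one more letter reaches its target.
  have hle := hmax (w.trans (Equiv.swap (w (.inl c)) (e c))) ⟨?_, fun d => ?_⟩
  · refine absurd hle (not_le.2 (Finset.card_lt_card ?_))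
    rw [Finset.ssubset_iff_of_subset]
    · exact ⟨c, (hN _ _).2 (by simp), by simpa [hN] using hne⟩
    · intro d hd
      have hd := (hN w d).1 hd
      have hdc : d ≠ c := by rintro rfl; exact hne hd
      have h1 : w (.inl d) ≠ w (.inl c) := fun h => hdc (Sum.inl_injective (w.injective h))
      have h2 : w (.inl d) ≠ e c := by rw [hd]; exact fun h => hdc (he h)
      exact (hN _ _).2 (by rw [Equiv.trans_apply, Equiv.swap_apply_of_ne_of_ne h1 h2, hd])
  · rw [hF.cell_swap _ _ _ hne (by rw [hgood, hcol])]
    exact neg_ne_zero.2 hw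
  · rw [Equiv.trans_apply, Equiv.swap_apply_def]
    split_ifs with h1 h2
    · rw [hcol, ← hgood d, h1, hgood]
    · rw [hgood, ← hgood d, h2, hcol]
    · exact hgood d

end Straightening

/-! ### Exchange relations in Schur modules -/

section Exchange

variable {K E : Type*} [Field K] [AddCommGroup E] [Module K E]

theorem permute_mul {s : Finset (ℕ × ℕ)} (σ τ : Equiv.Perm s) (x : TPow K E s) :
    permute K E (σ * τ) x = permute K E σ (permute K E τ x) :=
  (PiTensorProduct.reindex_reindex (s := fun _ : s => E) τ σ x).symm

theorem permute_rowSym {s : Finset (ℕ × ℕ)} {ρ : Equiv.Perm s} (hρ : ∀ c, (ρ c).1.1 = c.1.1)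
    (x : TPow K E s) : permute K E ρ (rowSym K E s x) = rowSym K E s x := by
  simp only [rowSym, LinearMap.sum_apply, map_sum, ← permute_mul]
  refine Finset.sum_equiv (Equiv.mulLeft ρ) (fun σ => ?_) (fun σ _ => rfl)
  simp [rowPerms, hρ]

theorem permute_colAlt {s : Finset (ℕ × ℕ)} {ρ : Equiv.Perm s} (hρ : ∀ c, (ρ c).1.2 = c.1.2)
    (x : TPow K E s) : permute K E ρ (colAlt K E s x) =
      ((Equiv.Perm.sign ρ : ℤ) : K) • colAlt K E s x := by
  simp only [colAlt, LinearMap.sum_apply, map_sum, LinearMap.smul_apply, map_smul, ← permute_mul,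
    Finset.smul_sum, smul_smul]
  refine Finset.sum_equiv (Equiv.mulLeft ρ) (fun σ => ?_) (fun σ _ => ?_)
  · simp [colPerms, hρ]
  · rcases Int.units_eq_one_or (Equiv.Perm.sign ρ) with h | h <;> simp [h]

theorem swap_preserves {α : Type*} [DecidableEq α] (r : α → ℕ) {a b : α} (h : r a = r b) (c : α) :
    r (Equiv.swap a b c) = r c := by
  rw [Equiv.swap_apply_def]
  split_ifs with h1 h2
  · rw [h1, h]
  · rw [h2, h]
  · rfl

theorem permute_swap_schurModule {l : YoungDiagram} {f : TPow K E l.cells}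
    (hf : f ∈ schurModule K E l) {a b : l.cells} (hab : a ≠ b) (h : a.1.2 = b.1.2) :
    permute K E (Equiv.swap a b) f = -f := by
  obtain ⟨x, rfl⟩ := hf
  rw [youngSym, LinearMap.comp_apply,
    permute_colAlt (swap_preserves (fun c : l.cells => c.1.2) h), Equiv.Perm.sign_swap hab]
  simp

/-- Write `f = ∑ sign(σ) σ z` with `z` row symmetric, and pull the swaps through `σ`: they become
swaps of `q = σ⁻¹ x` with the cells `i` of column `k`. The cell in the row of `q` gives back `f`;
the others cancel in pairs. -/
theorem schurModule_exchange {l : YoungDiagram} {f : TPow K E l.cells}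
    (hf : f ∈ schurModule K E l) (x : l.cells) {k : ℕ} (hk : k < x.1.2) :
    f = ∑ i : l.cells with i.1.2 = k, permute K E (Equiv.swap x i) f := by
  obtain ⟨y, rfl⟩ := hf
  set z := rowSym K E l.cells y with hz
  have hyz : youngSym K E l.cells y = ∑ σ ∈ colPerms l.cells,
      ((Equiv.Perm.sign σ : ℤ) : K) • permute K E σ z := by
    simp [youngSym, colAlt, hz]
  have hrow : ∀ a b : l.cells, a.1.1 = b.1.1 → permute K E (Equiv.swap a b) z = z := fun a b h =>
    permute_rowSym (swap_preserves (fun c : l.cells => c.1.1) h) y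
  rw [hyz]
  have hcol : ∀ σ ∈ colPerms l.cells, ∀ c, (σ c).1.2 = c.1.2 := fun σ hσ => by
    simpa [colPerms] using hσ
  have hinv : ∀ σ ∈ colPerms l.cells, ∀ c, (σ⁻¹ c).1.2 = c.1.2 := fun σ hσ c => by
    rw [← hcol σ hσ (σ⁻¹ c), ← Equiv.Perm.mul_apply, mul_inv_cancel, Equiv.Perm.one_apply]
  -- the cell of the column `k` in the row of `q`
  let p : l.cells → l.cells := fun q => if h : (q.1.1, k) ∈ l.cells then ⟨(q.1.1, k), h⟩ else q
  have hp : ∀ q : l.cells, k < q.1.2 → (p q).1 = (q.1.1, k) := by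
    intro q hq
    have : (q.1.1, k) ∈ l.cells := by
      have h1 := q.2
      rw [YoungDiagram.mem_cells] at h1 ⊢
      exact l.up_left_mem le_rfl hq.le h1
    simp only [p, dif_pos this]
  let B : Finset l.cells := {i | i.1.2 = k}
  have hB : ∀ i, i ∈ B ↔ i.1.2 = k := fun i => by simp [B]
  have hsum : ∑ i ∈ B, permute K E (Equiv.swap x i)
        (∑ σ ∈ colPerms l.cells, ((Equiv.Perm.sign σ : ℤ) : K) • permute K E σ z) =
      ∑ σ ∈ colPerms l.cells, ∑ i ∈ B,
        ((Equiv.Perm.sign σ : ℤ) : K) • permute K E (σ * Equiv.swap (σ⁻¹ x) i) z := by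
    simp only [map_sum, map_smul, ← permute_mul]
    rw [Finset.sum_comm]
    refine Finset.sum_congr rfl fun σ hσ => ?_
    refine Finset.sum_equiv σ⁻¹ (fun i => ?_) (fun i _ => ?_)
    · rw [hB, hB, hinv σ hσ]
    · rw [Equiv.mul_swap_eq_swap_mul, ← Equiv.Perm.mul_apply, ← Equiv.Perm.mul_apply,
        mul_inv_cancel, Equiv.Perm.one_apply, Equiv.Perm.one_apply]
  change _ = ∑ i ∈ B, _
  rw [hsum]
  -- Swapping `q` with the cell of column `k` in its row fixes `z`. That cell exists because the
  -- diagram is straight and `k` is left of `q`.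
  have hsplit : ∀ σ ∈ colPerms l.cells, ∑ i ∈ B,
        ((Equiv.Perm.sign σ : ℤ) : K) • permute K E (σ * Equiv.swap (σ⁻¹ x) i) z =
      ((Equiv.Perm.sign σ : ℤ) : K) • permute K E σ z + ∑ i ∈ B.erase (p (σ⁻¹ x)),
        ((Equiv.Perm.sign σ : ℤ) : K) • permute K E (σ * Equiv.swap (σ⁻¹ x) i) z := by
    intro σ hσ
    have hq : k < (σ⁻¹ x).1.2 := by rwa [hinv σ hσ]
    rw [← Finset.add_sum_erase B _ ((hB (p (σ⁻¹ x))).2 (by rw [hp _ hq])), permute_mul, hrow]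
    rw [hp _ hq]
  rw [Finset.sum_congr rfl hsplit, Finset.sum_add_distrib, left_eq_add, Finset.sum_sigma']
  have hmem : ∀ a : (_ : Equiv.Perm l.cells) × l.cells,
      a ∈ (colPerms l.cells).sigma (fun σ => B.erase (p (σ⁻¹ x))) ↔
        a.1 ∈ colPerms l.cells ∧ a.2 ≠ p (a.1⁻¹ x) ∧ a.2 ∈ B := fun a => by
    rw [Finset.mem_sigma, Finset.mem_erase]
  have hfix : ∀ a ∈ (colPerms l.cells).sigma (fun σ => B.erase (p (σ⁻¹ x))),
      (a.1 * Equiv.swap (p (a.1⁻¹ x)) a.2)⁻¹ x = a.1⁻¹ x := by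
    intro a ha
    obtain ⟨h1, h2, h3⟩ := (hmem a).1 ha
    have hq : k < (a.1⁻¹ x).1.2 := by rwa [hinv _ h1]
    rw [mul_inv_rev, Equiv.swap_inv, Equiv.Perm.mul_apply, Equiv.swap_apply_of_ne_of_ne]
    · intro h; have h' := hp _ hq; rw [← h] at h'; rw [h'] at hq; exact hq.false
    · intro h; rw [h, (hB _).1 h3] at hq; exact hq.false
  -- With `p = p q`, one has `σ (p i)(q i) = σ (q i)(q p)`, and `(q p)` fixes `z`. Replacing `σ` by
  -- `σ (p i)` thus changes only the sign of the term; it keeps `q`, hence is an involution.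
  refine (Finset.sum_involution (fun a _ => ⟨a.1 * Equiv.swap (p (a.1⁻¹ x)) a.2, a.2⟩)
    ?_ ?_ ?_ ?_)
  · intro a ha
    obtain ⟨h1, h2, h3⟩ := (hmem a).1 ha
    have hq : k < (a.1⁻¹ x).1.2 := by rwa [hinv _ h1]
    simp only [hfix a ha]
    set q := a.1⁻¹ x
    have hqi : q ≠ a.2 := by intro h; rw [h, (hB _).1 h3] at hq; exact hq.false
    have hqp : q ≠ p q := by intro h; have h' := hp _ hq; rw [← h] at h'; rw [h'] at hq; exact hq.false
    have : a.1 * Equiv.swap (p q) a.2 * Equiv.swap q a.2 =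
        a.1 * Equiv.swap q a.2 * Equiv.swap q (p q) := by
      rw [mul_assoc, mul_assoc, Equiv.mul_swap_eq_swap_mul (Equiv.swap q a.2),
        Equiv.swap_apply_left, Equiv.swap_apply_of_ne_of_ne hqp.symm h2.symm,
        Equiv.swap_comm a.2]
    rw [this, permute_mul (a.1 * _), hrow q (p q) (by rw [hp _ hq]), Equiv.Perm.sign_mul,
      Equiv.Perm.sign_swap h2.symm]
    simp
  · intro a ha _ h
    obtain ⟨h1, h2, h3⟩ := (hmem a).1 ha
    have h4 := congrArg Sigma.fst h
    simp only [mul_eq_left] at h4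
    exact h2.symm (Equiv.swap_eq_one_iff.1 h4)
  · intro a ha
    obtain ⟨h1, h2, h3⟩ := (hmem a).1 ha
    have hq : k < (a.1⁻¹ x).1.2 := by rwa [hinv _ h1]
    rw [hmem]
    simp only [hfix a ha]
    refine ⟨?_, h2, h3⟩
    simp only [colPerms, Finset.mem_filter, Finset.mem_univ, true_and, Equiv.Perm.mul_apply]
    intro c
    rw [hcol _ h1, swap_preserves (fun c : l.cells => c.1.2)]
    rw [hp _ hq, (hB _).1 h3]
  · intro a ha
    simp only [hfix a ha, mul_assoc, Equiv.swap_mul_self, mul_one]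

end Exchange

/-! ### Placing the factors of a tensor in prescribed positions -/

section Placement

variable {K E : Type*} [Field K] [AddCommGroup E] [Module K E] {A I J : Type}

/-- The tensor with the factors of `g` and `ξ` in the cells prescribed by `w`. -/
def place {R : Type} (w : A ⊕ R ≃ I) (g : ⨂[K] _ : A, E) (ξ : ⨂[K] _ : R, E) : ⨂[K] _ : I, E :=
  PiTensorProduct.reindex K (fun _ => E) w (PiTensorProduct.tmulEquiv K E (g ⊗ₜ ξ))

@[simp]
theorem place_tprod {R : Type} (w : A ⊕ R ≃ I) (a : A → E) (b : R → E) :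
    place w (PiTensorProduct.tprod K a) (PiTensorProduct.tprod K b) =
      PiTensorProduct.tprod K fun i => Sum.elim a b (w.symm i) := by
  rw [place, PiTensorProduct.tmulEquiv_apply, PiTensorProduct.reindex_tprod]

/-- `place` as a bilinear map. -/
def placeₗ {R : Type} (w : A ⊕ R ≃ I) :
    (⨂[K] _ : A, E) →ₗ[K] (⨂[K] _ : R, E) →ₗ[K] ⨂[K] _ : I, E :=
  (TensorProduct.mk K _ _).compr₂
    ((PiTensorProduct.tmulEquiv K E).trans
      (PiTensorProduct.reindex K (fun _ => E) w)).toLinearMap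

theorem placeₗ_apply {R : Type} (w : A ⊕ R ≃ I) (g : ⨂[K] _ : A, E) (ξ : ⨂[K] _ : R, E) :
    placeₗ w g ξ = place w g ξ := rfl

theorem place_trans {R : Type} (w : A ⊕ R ≃ I) (σ : I ≃ J) (g : ⨂[K] _ : A, E)
    (ξ : ⨂[K] _ : R, E) :
    place (w.trans σ) g ξ = PiTensorProduct.reindex K (fun _ => E) σ (place w g ξ) :=
  (PiTensorProduct.reindex_reindex (s := fun _ => E) w σ _).symm

/-- Two linear maps which agree on the pure tensors agree. -/
theorem linearMap_congr_tprod {M : Type*} [AddCommGroup M] [Module K M]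
    {φ ψ : (⨂[K] _ : A, E) →ₗ[K] M}
    (h : ∀ a, φ (PiTensorProduct.tprod K a) = ψ (PiTensorProduct.tprod K a))
    (x : ⨂[K] _ : A, E) : φ x = ψ x := by
  rw [show φ = ψ from PiTensorProduct.ext (MultilinearMap.ext h)]

theorem place_sumCongr {A' R R' : Type} (e : A ≃ A') (e' : R ≃ R') (w : A' ⊕ R' ≃ I)
    (g : ⨂[K] _ : A, E) (ξ : ⨂[K] _ : R, E) :
    place ((e.sumCongr e').trans w) g ξ =
      place w (PiTensorProduct.reindex K (fun _ => E) e g)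
        (PiTensorProduct.reindex K (fun _ => E) e' ξ) := by
  refine linearMap_congr_tprod (φ := (placeₗ ((e.sumCongr e').trans w)).flip ξ)
    (ψ := (placeₗ w).flip (PiTensorProduct.reindex K (fun _ => E) e' ξ) ∘ₗ
      (PiTensorProduct.reindex K (fun _ => E) e).toLinearMap) (fun a => ?_) g
  refine linearMap_congr_tprod (φ := placeₗ ((e.sumCongr e').trans w) (PiTensorProduct.tprod K a))
    (ψ := placeₗ w (PiTensorProduct.reindex K (fun _ => E) e (PiTensorProduct.tprod K a)) ∘ₗ
      (PiTensorProduct.reindex K (fun _ => E) e').toLinearMap) (fun b => ?_) ξ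
  simp only [LinearMap.comp_apply, LinearEquiv.coe_coe, placeₗ_apply,
    PiTensorProduct.reindex_tprod, place_tprod]
  congr 1
  ext i
  simp only [Equiv.symm_trans_apply]
  rcases w.symm i with c | c <;> rfl

/-- Associativity of the tensor product; it makes `placeSpan` stable under tensoring with further
factors. -/
theorem place_place {R S : Type} (w : A ⊕ R ≃ I) (u : I ⊕ S ≃ J) (g : ⨂[K] _ : A, E)
    (ξ : ⨂[K] _ : R, E) (ζ : ⨂[K] _ : S, E) :
    place u (place w g ξ) ζ =
      place ((Equiv.sumAssoc A R S).symm.trans ((w.sumCongr (Equiv.refl S)).trans u)) g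
        (place (Equiv.refl _) ξ ζ) := by
  refine linearMap_congr_tprod (φ := (placeₗ u).flip ζ ∘ₗ (placeₗ w).flip ξ)
    (ψ := (placeₗ ((Equiv.sumAssoc A R S).symm.trans ((w.sumCongr (Equiv.refl S)).trans u))).flip
      (place (Equiv.refl _) ξ ζ)) (fun a => ?_) g
  refine linearMap_congr_tprod (φ := (placeₗ u).flip ζ ∘ₗ placeₗ w (PiTensorProduct.tprod K a))
    (ψ := placeₗ ((Equiv.sumAssoc A R S).symm.trans ((w.sumCongr (Equiv.refl S)).trans u))
      (PiTensorProduct.tprod K a) ∘ₗ (placeₗ (Equiv.refl _)).flip ζ) (fun b => ?_) ξ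
  refine linearMap_congr_tprod (φ := placeₗ u (placeₗ w (PiTensorProduct.tprod K a)
      (PiTensorProduct.tprod K b)))
    (ψ := placeₗ ((Equiv.sumAssoc A R S).symm.trans ((w.sumCongr (Equiv.refl S)).trans u))
      (PiTensorProduct.tprod K a) ∘ₗ (placeₗ (Equiv.refl _) (PiTensorProduct.tprod K b)))
    (fun c => ?_) ζ
  simp only [LinearMap.comp_apply, placeₗ_apply, place_tprod]
  congr 1
  ext i
  simp only [Equiv.symm_trans_apply]
  rcases u.symm i with c | c
  · simp only [Sum.elim_inl, Equiv.sumCongr_symm, Equiv.sumCongr_apply, Sum.map_inl]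
    rcases w.symm c with d | d <;> rfl
  · rfl

theorem place_comm {R : Type} (w : A ⊕ R ≃ I) (g : ⨂[K] _ : A, E) (ξ : ⨂[K] _ : R, E) :
    place w g ξ = place ((Equiv.sumComm R A).trans w) ξ g := by
  refine linearMap_congr_tprod (φ := (placeₗ w).flip ξ)
    (ψ := placeₗ ((Equiv.sumComm R A).trans w) ξ) (fun a => ?_) g
  refine linearMap_congr_tprod (φ := placeₗ w (PiTensorProduct.tprod K a))
    (ψ := (placeₗ ((Equiv.sumComm R A).trans w)).flip (PiTensorProduct.tprod K a))
    (fun b => ?_) ξ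
  simp only [LinearMap.flip_apply, placeₗ_apply, place_tprod]
  congr 1
  ext i
  simp only [Equiv.symm_trans_apply]
  rcases w.symm i with c | c <;> rfl

theorem place_empty (g : ⨂[K] _ : A, E) :
    place (Equiv.sumEmpty A Empty) g (PiTensorProduct.tprod K Empty.elim) = g := by
  refine linearMap_congr_tprod
    (φ := (placeₗ (Equiv.sumEmpty A Empty)).flip (PiTensorProduct.tprod K Empty.elim))
    (ψ := LinearMap.id) (fun a => ?_) g
  simp [placeₗ_apply]

/-- The span of all the tensors obtained by tensoring `g` with something and permuting the
factors. -/
def placeSpan (g : ⨂[K] _ : A, E) (I : Type) : Submodule K (⨂[K] _ : I, E) :=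
  Submodule.span K {y | ∃ (R : Type) (w : A ⊕ R ≃ I) (ξ : ⨂[K] _ : R, E), y = place w g ξ}

variable {g : ⨂[K] _ : A, E}

theorem self_mem_placeSpan : g ∈ placeSpan g A :=
  Submodule.subset_span ⟨_, _, _, (place_empty g).symm⟩

theorem reindex_mem_placeSpan {y : ⨂[K] _ : I, E} (hy : y ∈ placeSpan g I) (σ : I ≃ J) :
    PiTensorProduct.reindex K (fun _ => E) σ y ∈ placeSpan g J := by
  change y ∈ (placeSpan g J).comap (PiTensorProduct.reindex K (fun _ => E) σ).toLinearMap
  refine Submodule.span_le.2 ?_ hy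
  rintro _ ⟨R, w, ξ, rfl⟩
  exact Submodule.subset_span ⟨R, _, ξ, (place_trans w σ g ξ).symm⟩

theorem place_mem_placeSpan_left {R : Type} {y : ⨂[K] _ : I, E} (hy : y ∈ placeSpan g I)
    (u : I ⊕ R ≃ J) (ζ : ⨂[K] _ : R, E) : place u y ζ ∈ placeSpan g J := by
  change y ∈ (placeSpan g J).comap ((placeₗ u).flip ζ)
  refine Submodule.span_le.2 ?_ hy
  rintro _ ⟨R, w, ξ, rfl⟩
  exact Submodule.subset_span ⟨_, _, _, place_place w u g ξ ζ⟩

theorem place_mem_placeSpan_right {R : Type} {y : ⨂[K] _ : I, E} (hy : y ∈ placeSpan g I)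
    (u : R ⊕ I ≃ J) (ζ : ⨂[K] _ : R, E) : place u ζ y ∈ placeSpan g J := by
  rw [place_comm]
  exact place_mem_placeSpan_left hy _ _

end Placement

/-! ### Products are combinations of placements -/

section PlacementCells

variable {K E : Type*} [Field K] [AddCommGroup E] [Module K E] {A : Type} {g : ⨂[K] _ : A, E}

theorem rowSym_mem_placeSpan {s : Finset (ℕ × ℕ)} {y : TPow K E s} (hy : y ∈ placeSpan g s) :
    rowSym K E s y ∈ placeSpan g s := by
  rw [rowSym, LinearMap.sum_apply]
  exact Submodule.sum_mem _ fun σ _ => reindex_mem_placeSpan hy σ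

theorem colAlt_mem_placeSpan {s : Finset (ℕ × ℕ)} {y : TPow K E s} (hy : y ∈ placeSpan g s) :
    colAlt K E s y ∈ placeSpan g s := by
  rw [colAlt, LinearMap.sum_apply]
  exact Submodule.sum_mem _ fun σ _ => Submodule.smul_mem _ _ (reindex_mem_placeSpan hy σ)

/-- The product only permutes, tensors and takes linear combinations. Of the tableau, only the
bijection of cells it defines enters. -/
theorem LRTableau.mulTensor_mem_placeSpan {lam mu nu : YoungDiagram} (T : LRTableau lam mu nu)
    {x : TPow K E lam.cells} {y : TPow K E mu.cells}
    (h : x ∈ placeSpan g lam.cells ∨ y ∈ placeSpan g mu.cells) :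
    T.mulTensor K E x y ∈ placeSpan g nu.cells := by
  have : T.mulTensor K E x y = colAlt K E nu.cells
      (((rowPerms lam.cells).card * (rowPerms (nu.cells \ lam.cells)).card : K)⁻¹ •
        rowSym K E nu.cells (place (splitCells (YoungDiagram.cells_subset_iff.2 T.le))
          (rowSym K E lam.cells x) (T.transport K E (rowSym K E mu.cells y)))) := rfl
  rw [this]
  refine colAlt_mem_placeSpan (Submodule.smul_mem _ _ (rowSym_mem_placeSpan ?_))
  rcases h with h | h
  · exact place_mem_placeSpan_left (rowSym_mem_placeSpan h) _ _
  · exact place_mem_placeSpan_right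
      (rowSym_mem_placeSpan (reindex_mem_placeSpan (rowSym_mem_placeSpan h) _)) _ _

end PlacementCells

/-! ### Contraction as the adjoint of placement -/

section Pairing

variable {K V : Type*} [Field K] [AddCommGroup V] [Module K V]

theorem dualDistrib_reindex {I J : Type} [Finite I] [Finite J] (σ : I ≃ J)
    (y : ⨂[K] _ : I, Module.Dual K V) (f : ⨂[K] _ : I, V) :
    PiTensorProduct.dualDistrib (PiTensorProduct.reindex K (fun _ => Module.Dual K V) σ y)
      (PiTensorProduct.reindex K (fun _ => V) σ f) = PiTensorProduct.dualDistrib y f := by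
  have := Fintype.ofFinite I
  have := Fintype.ofFinite J
  refine linearMap_congr_tprod
    (φ := PiTensorProduct.dualDistrib (PiTensorProduct.reindex K (fun _ => Module.Dual K V) σ y) ∘ₗ
      (PiTensorProduct.reindex K (fun _ => V) σ).toLinearMap)
    (ψ := PiTensorProduct.dualDistrib y) (fun v => ?_) f
  refine linearMap_congr_tprod
    (φ := (PiTensorProduct.dualDistrib.flip (PiTensorProduct.reindex K (fun _ => V) σ
      (PiTensorProduct.tprod K v))) ∘ₗ
      (PiTensorProduct.reindex K (fun _ => Module.Dual K V) σ).toLinearMap)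
    (ψ := PiTensorProduct.dualDistrib.flip (PiTensorProduct.tprod K v)) (fun α => ?_) y
  simp only [LinearMap.comp_apply, LinearEquiv.coe_coe, LinearMap.flip_apply,
    PiTensorProduct.reindex_tprod, PiTensorProduct.dualDistrib_apply]
  exact Equiv.prod_comp σ.symm fun i => α i (v i)

theorem dualDistrib_permute_swap {s : Finset (ℕ × ℕ)} (a b : s)
    (y : TPow K (Module.Dual K V) s) (f : TPow K V s) :
    PiTensorProduct.dualDistrib (permute K (Module.Dual K V) (Equiv.swap a b) y) f =
      PiTensorProduct.dualDistrib y (permute K V (Equiv.swap a b) f) := by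
  rw [← dualDistrib_reindex (Equiv.swap a b) y]
  change _ = PiTensorProduct.dualDistrib (permute K (Module.Dual K V) (Equiv.swap a b) y)
    (permute K V (Equiv.swap a b) (permute K V (Equiv.swap a b) f))
  rw [← permute_mul, Equiv.swap_mul_self]
  congr 1
  simp [permute, Equiv.Perm.one_def, PiTensorProduct.reindex_refl]

theorem dualDistrib_place_place {A R I : Type} [Finite A] [Finite R] [Finite I]
    (w : A ⊕ R ≃ I) (g : ⨂[K] _ : A, Module.Dual K V) (ξ : ⨂[K] _ : R, Module.Dual K V)
    (p : ⨂[K] _ : A, V) (q : ⨂[K] _ : R, V) :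
    PiTensorProduct.dualDistrib (place w g ξ) (place w p q) =
      PiTensorProduct.dualDistrib g p * PiTensorProduct.dualDistrib ξ q := by
  have := Fintype.ofFinite A
  have := Fintype.ofFinite R
  have := Fintype.ofFinite I
  refine linearMap_congr_tprod
    (φ := PiTensorProduct.dualDistrib (place w g ξ) ∘ₗ (placeₗ w).flip q)
    (ψ := (LinearMap.mul K K).flip (PiTensorProduct.dualDistrib ξ q) ∘ₗ
      PiTensorProduct.dualDistrib g) (fun a => ?_) p
  refine linearMap_congr_tprod
    (φ := PiTensorProduct.dualDistrib (place w g ξ) ∘ₗ placeₗ w (PiTensorProduct.tprod K a))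
    (ψ := (LinearMap.mul K K) (PiTensorProduct.dualDistrib g (PiTensorProduct.tprod K a)) ∘ₗ
      PiTensorProduct.dualDistrib ξ) (fun b => ?_) q
  refine linearMap_congr_tprod
    (φ := PiTensorProduct.dualDistrib.flip (place w (PiTensorProduct.tprod K a)
      (PiTensorProduct.tprod K b)) ∘ₗ (placeₗ w).flip ξ)
    (ψ := (LinearMap.mul K K).flip (PiTensorProduct.dualDistrib ξ (PiTensorProduct.tprod K b)) ∘ₗ
      PiTensorProduct.dualDistrib.flip (PiTensorProduct.tprod K a)) (fun α => ?_) g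
  refine linearMap_congr_tprod
    (φ := PiTensorProduct.dualDistrib.flip (place w (PiTensorProduct.tprod K a)
      (PiTensorProduct.tprod K b)) ∘ₗ placeₗ w (PiTensorProduct.tprod K α))
    (ψ := (LinearMap.mul K K) (PiTensorProduct.dualDistrib (PiTensorProduct.tprod K α)
      (PiTensorProduct.tprod K a)) ∘ₗ
      PiTensorProduct.dualDistrib.flip (PiTensorProduct.tprod K b)) (fun β => ?_) ξ
  simp only [LinearMap.comp_apply, LinearMap.flip_apply, placeₗ_apply, place_tprod,
    PiTensorProduct.dualDistrib_apply, LinearMap.mul_apply']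
  rw [Equiv.prod_comp w.symm fun i => (Sum.elim α β i) (Sum.elim a b i), Fintype.prod_sum_type]
  rfl

theorem dualDistrib_contract {s t : Finset (ℕ × ℕ)} (h : s ⊆ t) (f : TPow K V t)
    (g : TPow K (Module.Dual K V) s) (ξ : TPow K (Module.Dual K V) (t \ s)) :
    PiTensorProduct.dualDistrib ξ (contract h f g) =
      PiTensorProduct.dualDistrib (place (splitCells h) g ξ) f := by
  obtain ⟨z, rfl⟩ := (joinTensor K V h).surjective f
  induction z with
  | zero => simp [contract]
  | add x y hx hy =>
    rw [map_add, map_add, ← hx, ← hy, ← map_add]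
    simp [contract]
  | tmul p q =>
    change _ = PiTensorProduct.dualDistrib (place (splitCells h) g ξ) (place (splitCells h) p q)
    rw [dualDistrib_place_place]
    simp [contract]

/-- In finite dimension every functional on the tensor power comes from a tensor of functionals. -/
theorem eq_zero_of_dualDistrib [FiniteDimensional K V] {I : Type} [Finite I] {f : ⨂[K] _ : I, V}
    (h : ∀ ξ : ⨂[K] _ : I, Module.Dual K V, PiTensorProduct.dualDistrib ξ f = 0) : f = 0 := by
  refine (Module.forall_dual_apply_eq_zero_iff K f).1 fun φ => ?_
  rw [← (PiTensorProduct.dualDistribEquiv (R := K) (M := fun _ : I => V)).apply_symm_apply φ]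
  exact h _

theorem contract_eq_zero_iff [FiniteDimensional K V] {s t : Finset (ℕ × ℕ)} (h : s ⊆ t)
    (f : TPow K V t) (g : TPow K (Module.Dual K V) s) : contract h f g = 0 ↔
      ∀ ξ, PiTensorProduct.dualDistrib (place (splitCells h) g ξ) f = 0 := by
  simp only [← dualDistrib_contract]
  exact ⟨fun h ξ => by rw [h, map_zero], eq_zero_of_dualDistrib⟩

end Pairing

/-! ### Apolarity in one position implies apolarity in all -/

section Annihilation

variable {K V : Type*} [Field K] [AddCommGroup V] [Module K V]
  {eta lam : YoungDiagram}

theorem catalecticant_of_not_le {mu : YoungDiagram} (f : schurModule K V eta) (h : ¬mu ≤ eta) :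
    catalecticant f mu = 0 := dif_neg h

theorem catalecticant_eq_zero_iff [CharZero K] {mu : YoungDiagram} (f : schurModule K V eta) (h : mu ≤ eta)
    (g : schurModule K (Module.Dual K V) mu) :
    catalecticant f mu g = 0 ↔
      contract (YoungDiagram.cells_subset_iff.2 h) f.1 g.1 = 0 := by
  have hc : ((colPerms mu.cells).card : K)⁻¹ ≠ 0 :=
    inv_ne_zero (Nat.cast_ne_zero.2 (Finset.card_ne_zero.2 ⟨1, by simp [colPerms]⟩))
  rw [catalecticant, dif_pos h]
  simp [hc, -inv_eq_zero]

/-- Swaps of cells pass through the pairing to `f`, and swaps of letters act on `g`. The four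
relations are those of the two Schur modules. -/
theorem isExchange_dualDistrib {f : TPow K V eta.cells} (hf : f ∈ schurModule K V eta)
    {g : TPow K (Module.Dual K V) lam.cells} (hg : g ∈ schurModule K (Module.Dual K V) lam)
    {R : Type} [DecidableEq R] (ξ : ⨂[K] _ : R, Module.Dual K V) :
    IsExchange (fun c : lam.cells => c.1.2) (fun c : eta.cells => c.1.2)
      (fun w : lam.cells ⊕ R ≃ eta.cells => PiTensorProduct.dualDistrib (place w g ξ) f) := by
  have hcell : ∀ (w : lam.cells ⊕ R ≃ eta.cells) (a b : eta.cells),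
      PiTensorProduct.dualDistrib (place (w.trans (Equiv.swap a b)) g ξ) f =
        PiTensorProduct.dualDistrib (place w g ξ) (permute K V (Equiv.swap a b) f) :=
    fun w a b => by
      rw [place_trans]
      exact dualDistrib_permute_swap a b _ f
  have hletter : ∀ (w : lam.cells ⊕ R ≃ eta.cells) (a b : lam.cells),
      place ((Equiv.swap (.inl a) (.inl b)).trans w) g ξ =
        place w (permute K (Module.Dual K V) (Equiv.swap a b) g) ξ := fun w a b => by
    have : Equiv.swap (Sum.inl a : lam.cells ⊕ R) (.inl b) =
        (Equiv.swap a b).sumCongr (Equiv.refl R) :=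
      (Equiv.Perm.sumCongr_swap_refl a b).symm
    rw [this, place_sumCongr, PiTensorProduct.reindex_refl]
    rfl
  refine ⟨fun w a b hab h => ?_, fun w x k hk => ?_, fun w a b hab h => ?_, fun w x k hk => ?_⟩
  · rw [hcell, permute_swap_schurModule hf hab h, map_neg]
  · simp only [hcell]
    conv_lhs => rw [schurModule_exchange hf x hk]
    rw [map_sum]
  · rw [hletter, permute_swap_schurModule hg hab h]
    exact map_neg (PiTensorProduct.dualDistrib.flip f ∘ₗ (placeₗ w).flip ξ) g
  · simp only [hletter, ← placeₗ_apply]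
    conv_lhs => rw [schurModule_exchange hg x hk]
    simp only [map_sum, LinearMap.sum_apply]

/-- Each column of `lam` injects into the same column of `eta`, so no column of `lam` is longer. -/
theorem le_of_col_preserving {R : Type} (w : lam.cells ⊕ R ≃ eta.cells)
    (h : ∀ c, (w (.inl c)).1.2 = c.1.2) : lam ≤ eta := by
  rw [← YoungDiagram.cells_subset_iff]
  rintro ⟨i, j⟩ hij
  rw [YoungDiagram.mem_cells] at hij ⊢
  have hmem : ∀ a : Fin (lam.colLen j), ((a : ℕ), j) ∈ lam.cells := fun a => by
    rw [YoungDiagram.mem_cells]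
    exact YoungDiagram.mem_iff_lt_colLen.2 a.2
  let φ : Fin (lam.colLen j) → Fin (eta.colLen j) := fun a =>
    ⟨(w (.inl ⟨_, hmem a⟩)).1.1, by
      have h1 := (w (.inl ⟨_, hmem a⟩)).2
      rw [YoungDiagram.mem_cells] at h1
      exact lt_of_lt_of_eq (YoungDiagram.mem_iff_lt_colLen.1 h1) (congrArg eta.colLen (h _))⟩
  have hφ : Function.Injective φ := by
    intro a b hab
    have h1 : (w (.inl ⟨_, hmem a⟩)) = (w (.inl ⟨_, hmem b⟩)) :=
      Subtype.ext (Prod.ext (congrArg Fin.val hab) ((h ⟨_, hmem a⟩).trans (h ⟨_, hmem b⟩).symm))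
    have h2 := congrArg (fun c => c.1.1) (Sum.inl_injective (w.injective h1))
    exact Fin.ext h2
  have hcard := Fintype.card_le_of_injective φ hφ
  simp only [Fintype.card_fin] at hcard
  rw [YoungDiagram.mem_iff_lt_colLen] at hij ⊢
  omega

/-- A placement which puts the letters `lam` in the cells `lam` factors through `splitCells`. -/
theorem exists_splitCells_eq {s t : Finset (ℕ × ℕ)} (hst : s ⊆ t) {R : Type} (w : s ⊕ R ≃ t)
    (hw : ∀ c, w (.inl c) = ⟨c.1, hst c.2⟩) :
    ∃ e : R ≃ (t \ s : Finset (ℕ × ℕ)),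
      w = ((Equiv.refl s).sumCongr e).trans (splitCells hst) := by
  have hmem : ∀ r, (w (.inr r)).1 ∈ t \ s := by
    intro r
    refine Finset.mem_sdiff.2 ⟨(w (.inr r)).2, fun h => ?_⟩
    have : w (.inr r) = w (.inl ⟨_, h⟩) := by rw [hw]
    exact absurd (w.injective this) (by simp)
  refine ⟨Equiv.ofBijective (fun r => ⟨_, hmem r⟩) ⟨fun a b hab => ?_, fun d => ?_⟩, ?_⟩
  · have : w (.inr a) = w (.inr b) := Subtype.ext (congrArg (fun x => x.1) hab)
    exact Sum.inr_injective (w.injective this)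
  · have hd := Finset.mem_sdiff.1 d.2
    rcases hx : w.symm ⟨d.1, hd.1⟩ with c | r
    · rw [Equiv.symm_apply_eq, hw] at hx
      exact absurd (by rw [congrArg Subtype.val hx]; exact c.2) hd.2
    · rw [Equiv.symm_apply_eq] at hx
      exact ⟨r, Subtype.ext (congrArg Subtype.val hx).symm⟩
  · refine Equiv.ext fun x => ?_
    rcases x with c | r
    · rw [hw]; rfl
    · rfl

/-- If `g` is apolar to `f`, the contractions of `f` with `g` in arbitrary positions vanish. -/
theorem dualDistrib_eq_zero_of_mem_placeSpan [CharZero K] (f : schurModule K V eta)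
    (g : schurModule K (Module.Dual K V) lam) (hg : catalecticant f lam g = 0)
    {y : TPow K (Module.Dual K V) eta.cells} (hy : y ∈ placeSpan g.1 eta.cells) :
    PiTensorProduct.dualDistrib y f.1 = 0 := by
  classical
  change y ∈ LinearMap.ker (PiTensorProduct.dualDistrib.flip f.1)
  refine Submodule.span_le.2 ?_ hy
  rintro _ ⟨R, w, ξ, rfl⟩
  change PiTensorProduct.dualDistrib (place w g.1 ξ) f.1 = 0
  by_contra hne
  have : Finite R := Finite.of_injective _ (w.injective.comp Sum.inr_injective)
  have := Fintype.ofFinite R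
  have hF := isExchange_dualDistrib f.2 g.2 ξ
  obtain ⟨v, -, hv⟩ := hF.exists_col hne
  -- When `lam ⊄ eta` the catalecticant is zero by convention and `hg` is empty; a nonzero pairing
  -- excludes this case.
  have hle : lam ≤ eta := le_of_col_preserving v hv
  have hsub := YoungDiagram.cells_subset_iff.2 hle
  obtain ⟨u, hu, huc⟩ := hF.exists_eq hne (fun c => ⟨c.1, hsub c.2⟩)
    (fun a b h => Subtype.ext (congrArg (fun x => x.1) h)) (fun _ => rfl)
  obtain ⟨e, rfl⟩ := exists_splitCells_eq hsub u huc
  rw [catalecticant_eq_zero_iff f hle] at hg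
  apply hu
  rw [place_sumCongr, PiTensorProduct.reindex_refl, ← dualDistrib_contract, LinearEquiv.refl_apply,
    hg, map_zero]

theorem catalecticant_eq_zero_of_mem_placeSpan [CharZero K] [FiniteDimensional K V] {nu : YoungDiagram}
    (f : schurModule K V eta) (g : schurModule K (Module.Dual K V) lam)
    (hg : catalecticant f lam g = 0) (z : schurModule K (Module.Dual K V) nu)
    (hz : z.1 ∈ placeSpan g.1 nu.cells) : catalecticant f nu z = 0 := by
  by_cases h : nu ≤ eta
  · rw [catalecticant_eq_zero_iff f h, contract_eq_zero_iff]
    exact fun ξ => dualDistrib_eq_zero_of_mem_placeSpan f g hg (place_mem_placeSpan_left hz _ _)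
  · rw [catalecticant_of_not_le f h, LinearMap.zero_apply]

end Annihilation

/-! ### The apolar ideal and the generators of the ideal of a point -/

section Main

variable {K V : Type*} [Field K] [AddCommGroup V] [Module K V]
  {eta : YoungDiagram}

theorem mem_apolarSet {f : schurModule K V eta}
    {g : SchurSum K (Module.Dual K V) (Module.finrank K V)} :
    g ∈ apolarSet f ↔ ∀ mu : ShortPartition (Module.finrank K V),
      catalecticant f mu.1 (DirectSum.component K _ _ mu g) = 0 := by
  simp [apolarSet]

theorem lof_mem_apolarSet {f : schurModule K V eta} {nu : ShortPartition (Module.finrank K V)}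
    {z : schurModule K (Module.Dual K V) nu.1} (hz : catalecticant f nu.1 z = 0) :
    DirectSum.lof K (ShortPartition (Module.finrank K V))
      (fun l => schurModule K (Module.Dual K V) l.1) nu z ∈ apolarSet f := by
  rw [mem_apolarSet]
  intro mu
  by_cases h : nu = mu
  · subst h
    rw [DirectSum.component.lof_self, hz]
  · rw [DirectSum.component.of, dif_neg h, map_zero]

theorem apolarity_eq_zero {f : schurModule K V eta}
    {g : SchurSum K (Module.Dual K V) (Module.finrank K V)} (hg : g ∈ apolarSet f) :
    apolarity f g = 0 := by
  refine DFinsupp.ext fun mu => ?_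
  exact mem_apolarSet.1 hg mu

theorem isSchurIdeal_apolarSet [CharZero K] [FiniteDimensional K V] (f : schurModule K V eta) :
    IsSchurIdeal (apolarSet f) := by
  intro lam mu nu T
  refine ⟨fun g hg h => lof_mem_apolarSet ?_, fun g hg h => lof_mem_apolarSet ?_⟩
  · exact catalecticant_eq_zero_of_mem_placeSpan f _ (mem_apolarSet.1 hg lam) _
      (T.mulTensor_mem_placeSpan (.inl self_mem_placeSpan))
  · exact catalecticant_eq_zero_of_mem_placeSpan f _ (mem_apolarSet.1 hg mu) _
      (T.mulTensor_mem_placeSpan (.inr self_mem_placeSpan))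

theorem youngSym_tprod_mem_span {E : Type*} [AddCommGroup E] [Module K E] (U : Submodule K E)
    {s : Finset (ℕ × ℕ)} {u : s → E} (hu : ∀ c, u c ∈ U) :
    youngSym K E s (PiTensorProduct.tprod K u) ∈
      Submodule.span K {x | ∃ u : s → E, (∀ c, u c ∈ U) ∧ x = PiTensorProduct.tprod K u} := by
  simp only [youngSym, colAlt, rowSym, LinearMap.comp_apply, LinearMap.sum_apply, map_sum,
    LinearMap.smul_apply, ← permute_mul]
  refine Submodule.sum_mem _ fun τ _ => Submodule.sum_mem _ fun σ _ => Submodule.smul_mem _ _ ?_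
  refine Submodule.subset_span ⟨fun c => u ((σ * τ).symm c), fun c => hu _, ?_⟩
  rw [permute, LinearEquiv.coe_coe, PiTensorProduct.reindex_tprod]

/-- With rows and columns counted from `0`, column `eta.rowLen h` has height at most `h`. In every
term of the flag tensor its cells carry vectors among `v 0, …, v (h - 1)`, which `u` annihilates. -/
theorem place_tprod_flagTensor_eq_zero {s : Finset (ℕ × ℕ)} (hs : s ⊆ eta.cells) {v : ℕ → V} {h : ℕ}
    {u : s → Module.Dual K V}
    (hu : ∀ c, u c ∈ (Submodule.span K (v '' Set.Iio h)).dualAnnihilator)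
    (hmem : (0, eta.rowLen h) ∈ s) (ξ : TPow K (Module.Dual K V) (eta.cells \ s)) :
    PiTensorProduct.dualDistrib (place (splitCells hs) (PiTensorProduct.tprod K u) ξ)
      (flagTensor eta v) = 0 := by
  refine linearMap_congr_tprod
    (φ := PiTensorProduct.dualDistrib.flip (flagTensor eta v) ∘ₗ
      placeₗ (splitCells hs) (PiTensorProduct.tprod K u)) (ψ := 0) (fun b => ?_) ξ
  simp only [LinearMap.comp_apply, LinearMap.flip_apply, placeₗ_apply, place_tprod, flagTensor,
    colAlt, LinearMap.sum_apply, map_sum, LinearMap.smul_apply, map_smul, LinearMap.zero_apply]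
  refine Finset.sum_eq_zero fun τ hτ => ?_
  have hcol : ∀ c, (τ c).1.2 = c.1.2 := by simpa [colPerms] using hτ
  rw [permute, LinearEquiv.coe_coe, PiTensorProduct.reindex_tprod,
    PiTensorProduct.dualDistrib_apply, smul_eq_mul]
  -- The vanishing factor is the one in the cell `(0, eta.rowLen h)`; `τ` permutes within columns,
  -- so the vector there comes from that same column.
  refine mul_eq_zero_of_right _ (Finset.prod_eq_zero
    (Finset.mem_univ (splitCells hs (.inl ⟨_, hmem⟩))) ?_)
  rw [Equiv.symm_apply_apply, Sum.elim_inl]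
  refine (Submodule.mem_dualAnnihilator _).1 (hu _) _ (Submodule.subset_span ⟨_, ?_, rfl⟩)
  set d := τ.symm (splitCells hs (.inl ⟨_, hmem⟩)) with hd
  have h1 : d.1.2 = eta.rowLen h := by
    rw [← hcol d, hd, Equiv.apply_symm_apply]
    rfl
  have h2 := d.2
  rw [YoungDiagram.mem_cells] at h2
  rw [Set.mem_Iio]
  by_contra hle
  have h3 : (h, eta.rowLen h) ∈ eta := by
    rw [← h1]
    exact eta.up_left_mem (not_lt.1 hle) le_rfl h2
  exact (YoungDiagram.mem_iff_lt_rowLen.1 h3).false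

theorem catalecticant_symPower_eq_zero [CharZero K] [FiniteDimensional K V]
    {p : schurModule K V eta} {v : ℕ → V} (hv : Represents p v) (h : ℕ)
    {x : schurModule K (Module.Dual K V) (oneRow (eta.rowLen h + 1))}
    (hx : x ∈ symPower (Submodule.span K (v '' Set.Iio h)).dualAnnihilator (eta.rowLen h + 1)) :
    catalecticant p (oneRow (eta.rowLen h + 1)) x = 0 := by
  by_cases hle : oneRow (eta.rowLen h + 1) ≤ eta
  swap
  · rw [catalecticant_of_not_le p hle, LinearMap.zero_apply]
  change x ∈ LinearMap.ker (catalecticant p (oneRow (eta.rowLen h + 1)))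
  refine Submodule.span_le.2 ?_ hx
  rintro x ⟨u, hu, hxu⟩
  change catalecticant p _ x = 0
  rw [catalecticant_eq_zero_iff p hle, contract_eq_zero_iff]
  intro ξ
  obtain ⟨-, a, -, hp⟩ := hv
  rw [hp, map_smul, hxu]
  refine smul_eq_zero_of_right _ ?_
  have hs := youngSym_tprod_mem_span _ hu
  generalize youngSym K (Module.Dual K V) (oneRow (eta.rowLen h + 1)).cells
    (PiTensorProduct.tprod K u) = y at hs
  change y ∈ LinearMap.ker (PiTensorProduct.dualDistrib.flip (flagTensor eta v) ∘ₗ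
    (placeₗ (splitCells (YoungDiagram.cells_subset_iff.2 hle))).flip ξ)
  refine Submodule.span_le.2 ?_ hs
  rintro _ ⟨u', hu', rfl⟩
  -- The `+ 1` in the degree is what makes the row reach column `eta.rowLen h`.
  exact place_tprod_flagTensor_eq_zero _ hu' (by simp [oneRow]) ξ

theorem pointIdeal_le_apolarSet [CharZero K] [FiniteDimensional K V] (p : schurModule K V eta) :
    pointIdeal p ≤ apolarSet p := by
  refine sInf_le ⟨isSchurIdeal_apolarSet p, ?_⟩
  rintro _ ⟨v, hv, h, -, hm, x, hx, rfl⟩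
  exact lof_mem_apolarSet (catalecticant_symPower_eq_zero hv h hx)

end Main

end SchurApolarity

end

theorem mainTheorem3 {K V : Type*} [Field K] [IsAlgClosed K] [CharZero K]
    [AddCommGroup V] [Module K V] [FiniteDimensional K V]
    (eta : YoungDiagram) (heta : eta.colLen 0 < Module.finrank K V) :
    (∀ p : SchurApolarity.schurModule K V eta, SchurApolarity.etaRank p = 1 →
      ∀ g ∈ SchurApolarity.pointIdeal p, SchurApolarity.apolarity p g = 0) ∧
    (∀ f : SchurApolarity.schurModule K V eta,
      SchurApolarity.IsSchurIdeal (SchurApolarity.apolarSet f)) :=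
  ⟨fun p _ _ hg => SchurApolarity.apolarity_eq_zero (SchurApolarity.pointIdeal_le_apolarSet p hg),
    SchurApolarity.isSchurIdeal_apolarSet⟩
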